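/- Let $\delta\in(0,1)$ and let $K_\delta=\{x+iy:\ x,y\in\mathbb R,\ \frac{x^2}{(1+\delta)^2}+\frac{y^2}{(1-\delta)^2}\le 1\}$. Let $\mathcal H$ be a complex Hilbert space, let $\mathcal B(\mathcal H)$ be the bounded linear operators on $\mathcal H$, and for $T\in\mathcal B(\mathcal H)$ let $W(T)=\{\langle Tx,x\rangle:\ \|x\|=1\}$ be its numerical range. Operators on the Hilbert space direct sum $\mathcal H\oplus\mathcal H$ are written as $2\times 2$ block matrices. Say that $T\in\mathcal B(\mathcal H)$ is *generic for $K_\delta$* if $\dim\mathcal H<\infty$, $\sigma(T)\subseteq K_\delta$, $\sigma(T)$ consists of $\dim\mathcal H$ distinct points, and $4\delta\notin\sigma(T^2)$. Say that $C\in\mathcal B(\mathcal H\oplus\mathcal H)$, with $n=\dim\mathcal H<\infty$, is a *$(\delta,\mathcal H)$-germinator* if $\|C\|\le 1$, $C$ has $2n$ distinct eigenvalues, $C$ is invertible with $$\delta C^{-1}=JCJ,\qquad J=\begin{bmatrix}1&0\\0&-1\end{bmatrix},$$ and $0\notin\sigma(C_{12})$, where $C_{12}\in\mathcal B(\mathcal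 H)$ is the $(1,2)$ entry of $C$. **Theorem.** Let $T\in\mathcal B(\mathcal H)$ be generic for $K_\delta$. There exist operators $Q\in\mathcal B(\mathcal H)$ commuting with $T$ and satisfying $Q^2=T^2-4\delta$; and for every such $Q$, with $$Z_T=\frac12\begin{bmatrix}T&Q\\Q&T\end{bmatrix},$$ the following hold. (a) $W(T)\subseteq K_\delta$ if and only if there exist a $(\delta,\mathcal H)$-germinator $C$ and an invertible $S\in\mathcal B(\mathcal H)$ such that $$C=\begin{bmatrix}1&0\\0&S\end{bmatrix}Z_T\begin{bmatrix}1&0\\0&S\end{bmatrix}^{-1}.\qquad(*)$$ (b) For every $(\delta,\mathcal H)$-germinator $C$ that satisfies $(*)$ with some invertible $S\in\mathcal B(\mathcal H)$, $T$ is the restriction of $C+\delta C^{-1}$ to $\mathcal H\oplus\{0\}\cong\mathcal H$; that is, $(C+\delta C^{-1})(h,0)=(Th,0)$ for all $h\in\mathcal H$. -/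

import Mathlib

namespace EllipseRange

noncomputable section

/-- The closed elliptical set `K_δ = {x + iy : x²/(1+δ)² + y²/(1-δ)² ≤ 1}`. -/
def ellipse (δ : ℝ) : Set ℂ :=
  {z : ℂ | z.re ^ 2 / (1 + δ) ^ 2 + z.im ^ 2 / (1 - δ) ^ 2 ≤ 1}

section Operators

variable {H : Type*} [NormedAddCommGroup H] [InnerProductSpace ℂ H]

/-- The numerical range `W(T) = {⟨T x, x⟩ : ‖x‖ = 1}`; Mathlib's inner product is linear in its
second argument. -/
def numericalRange (T : H →L[ℂ] H) : Set ℂ :=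
  {w : ℂ | ∃ x : H, ‖x‖ = 1 ∧ inner ℂ x (T x) = w}

/-- `T` is generic for `K_δ`: `σ(T) ⊆ K_δ`, `σ(T)` consists of `dim H` distinct points, and
`4δ ∉ σ(T²)`. -/
structure IsGeneric (δ : ℝ) (T : H →L[ℂ] H) : Prop where
  finiteDimensional : FiniteDimensional ℂ H
  spectrum_subset : spectrum ℂ T ⊆ ellipse δ
  card_spectrum : (spectrum ℂ T).encard = Module.finrank ℂ H
  not_mem_spectrum_sq : ((4 * δ : ℝ) : ℂ) ∉ spectrum ℂ (T ^ 2)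

variable (H) in
/-- The Hilbert space direct sum `H ⊕ H`. -/
abbrev DSum : Type _ := WithLp 2 (H × H)

/-- The operator `[[A, B], [C, D]]` on `H ⊕ H`. -/
def blockOp (A B C D : H →L[ℂ] H) : DSum H →L[ℂ] DSum H :=
  ((WithLp.prodContinuousLinearEquiv 2 ℂ H H).symm : (H × H) →L[ℂ] DSum H) ∘L
    ((A.coprod B).prod (C.coprod D)) ∘L
      (WithLp.prodContinuousLinearEquiv 2 ℂ H H : DSum H →L[ℂ] (H × H))

theorem blockOp_apply (A B C D : H →L[ℂ] H) (x y : H) :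
    blockOp A B C D (WithLp.toLp 2 (x, y)) = WithLp.toLp 2 (A x + B y, C x + D y) := rfl

/-- The `1`-`2` entry of an operator on `H ⊕ H`, so `C₁₂ y` is the first component of
`C (0, y)`. -/
def entry12 (C : DSum H →L[ℂ] DSum H) : H →L[ℂ] H :=
  ContinuousLinearMap.fst ℂ H H ∘L
    (WithLp.prodContinuousLinearEquiv 2 ℂ H H : DSum H →L[ℂ] (H × H)) ∘L C ∘L
      ((WithLp.prodContinuousLinearEquiv 2 ℂ H H).symm : (H × H) →L[ℂ] DSum H) ∘L
        ContinuousLinearMap.inr ℂ H H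

theorem entry12_apply (C : DSum H →L[ℂ] DSum H) (y : H) :
    entry12 C y = (C (WithLp.toLp 2 (0, y))).fst := rfl

/-- The symmetry `J = diag(1, -1)`. -/
def symJ : DSum H →L[ℂ] DSum H := blockOp 1 0 0 (-1)

/-- `diag(1, S)`. -/
def diagOne (S : H →L[ℂ] H) : DSum H →L[ℂ] DSum H := blockOp 1 0 0 S

/-- `C` is a `(δ, H)`-germinator. Here `Ring.inverse C` is the inverse of the invertible
operator `C`. -/
structure IsGerminator (δ : ℝ) (C : DSum H →L[ℂ] DSum H) : Prop where
  finiteDimensional : FiniteDimensional ℂ H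
  norm_le_one : ‖C‖ ≤ 1
  card_eigenvalues :
    {z : ℂ | Module.End.HasEigenvalue (C : DSum H →ₗ[ℂ] DSum H) z}.encard =
      2 * Module.finrank ℂ H
  isUnit : IsUnit C
  inverse_eq : (δ : ℂ) • Ring.inverse C = symJ * C * symJ
  zero_not_mem_spectrum : (0 : ℂ) ∉ spectrum ℂ (entry12 C)

/-- `Q` is an admissible square root for `T`: it commutes with `T` and `Q² = T² - 4δ`. -/
structure IsRoot (δ : ℝ) (T Q : H →L[ℂ] H) : Prop where
  commute : Commute Q T
  sq_eq : Q ^ 2 = T ^ 2 - ((4 * δ : ℝ) : ℂ) • (1 : H →L[ℂ] H)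

/-- `Z_T = ½ [[T, Q], [Q, T]]`, for the choice `Q` of square root. -/
def opZ (T Q : H →L[ℂ] H) : DSum H →L[ℂ] DSum H := (1 / 2 : ℂ) • blockOp T Q Q T

/-- The operator `diag(1, S)` is invertible when `S` is. -/
theorem isUnit_diagOne {S : H →L[ℂ] H} (hS : IsUnit S) : IsUnit (diagOne S) := by
  obtain ⟨u, rfl⟩ := hS
  refine ⟨⟨diagOne u, diagOne (↑u⁻¹ : H →L[ℂ] H), ?_, ?_⟩, rfl⟩
  · ext1 v
    obtain ⟨x, y⟩ := v
    have h : (u : H →L[ℂ] H) ((↑u⁻¹ : H →L[ℂ] H) y) = y := by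
      rw [← mul_apply_eq_comp, u.mul_inv]; rfl
    simp [diagOne, blockOp_apply, h]
  · ext1 v
    obtain ⟨x, y⟩ := v
    have h : (↑u⁻¹ : H →L[ℂ] H) ((u : H →L[ℂ] H) y) = y := by
      rw [← mul_apply_eq_comp, u.inv_mul]; rfl
    simp [diagOne, blockOp_apply, h]

end Operators

end

end EllipseRange

/-! Write `M = [[T, δ], [-1, 0]]` for `companion δ T`. Since `z ↦ z - δ z̄` maps `K_δ` onto the disc
of radius `1 - δ²`, the inclusion `W(T) ⊆ K_δ` says that `X = (T - δT†)/(1 - δ²)` has numerical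
radius at most one. Ando's theorem supplies a positive `A`; with `q(h) = ‖h‖² - (1 - δ²)⟨h, A h⟩`,
its inequality says exactly that `F(h, k) = ‖h‖² + q(k) + Re⟨h, T k⟩` does not increase under `M`.
With `T` replaced by `rT`, `r < 1`, and `q` adjusted, the powers of `M` tend to zero, so `F ≥ 0`;
letting `r → 1` gives `‖T k‖² ≤ 4 q(k)` (`norm_apply_sq_le`).

Completing the square, `F(h, k) = ‖h + T k / 2‖² + ‖R k / 2‖²` with `R ≥ 0`, and `4δ ∉ σ(T²)` makes
`R` invertible. In the coordinates `(h + T k / 2, -R k / 2)` the operator `M` becomes the conjugate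
of `Z_T` by `diag(1, S)` with `S = R Q⁻¹`, which is therefore a contraction
(`exists_norm_conjZ_le_one`). The other germinator conditions hold for every invertible `S`.

Conversely, testing a contraction `C` with `C J C J = δ` on combinations of `v = (h, 0)` and `J C J
v` bounds `⟨h, T h⟩ - δ ⟨T h, h⟩` (`numericalRange_subset_of_norm_conjZ_le_one`). Part (b) holds
because `C + J C J` is twice the diagonal part of `C`. -/

namespace EllipseRange

noncomputable section

/-! ### Ando's theorem on operators of numerical radius at most one. -/

section Ando

open UniformSpace InnerProductSpace ComplexConjugate

/-- A pair of isometries `V : H → E` and `U : E → E` with `V H ⟂ U ^ j V H` for `j ≥ 2` yields a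
positive operator `A` whose quadratic form dominates the form of `V† U V`. -/
theorem exists_isPositive_of_isometry {H E : Type*} [NormedAddCommGroup H] [InnerProductSpace ℂ H]
    [CompleteSpace H] [SeminormedAddCommGroup E] [InnerProductSpace ℂ E] (U : E →ₗᵢ[ℂ] E)
    (V : H →ₗᵢ[ℂ] E) (hVU : ∀ (j : ℕ) (h k : H), inner ℂ (V h) (U^[j + 2] (V k)) = 0) :
    ∃ A : H →L[ℂ] H, A.IsPositive ∧ ∀ h k : H,
      0 ≤ ‖h‖ ^ 2 - (inner ℂ h (A h)).re + 2 * (inner ℂ (V h) (U (V k))).re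
        + (inner ℂ k (A k)).re := by
  let i : E →ₗᵢ[ℂ] Completion E := Completion.toComplₗᵢ
  -- The span starts at the first power of `U`. `A` will measure the part of `V h` orthogonal to it,
  -- and `1 - A` the part inside its closure `L`.
  let M : Submodule ℂ E := Submodule.span ℂ {x | ∃ (j : ℕ) (h : H), x = U^[j + 1] (V h)}
  let L : Submodule ℂ (Completion E) := (M.map i.toLinearMap).topologicalClosure
  have : CompleteSpace L :=
    (Submodule.isClosed_topologicalClosure _).completeSpace_coe
  let R : Completion E →L[ℂ] Completion E := Lᗮ.starProjection
  let W : H →L[ℂ] Completion E := R ∘L (i.comp V).toContinuousLinearMap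
  have hW : ∀ h, W h = R (i (V h)) := fun h => rfl
  have hA : ∀ h, (inner ℂ h ((W.adjoint ∘L W) h)).re = ‖W h‖ ^ 2 := by
    intro h
    rw [ContinuousLinearMap.comp_apply, ContinuousLinearMap.adjoint_inner_right]
    exact inner_self_eq_norm_sq (𝕜 := ℂ) _
  have hpy : ∀ h, ‖h‖ ^ 2 = ‖L.starProjection (i (V h))‖ ^ 2 + ‖W h‖ ^ 2 := by
    intro h
    rw [hW, ← Submodule.norm_sq_eq_add_norm_sq_starProjection (i (V h)) L]
    simp
  have hUM : ∀ m ∈ M, ∀ h : H, inner ℂ (V h) (U m) = 0 := by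
    intro m hm h
    induction hm using Submodule.span_induction with
    | mem x hx =>
      obtain ⟨j, k, rfl⟩ := hx
      rw [← Function.iterate_succ_apply' U (j + 1)]
      exact hVU j h k
    | zero => simp
    | add x y _ _ hx hy => rw [map_add, inner_add_right, hx, hy, add_zero]
    | smul c x _ hx => rw [map_smul, inner_smul_right, hx, mul_zero]
  have hMU : ∀ m ∈ M, U m ∈ M := by
    intro m hm
    induction hm using Submodule.span_induction with
    | mem x hx =>
      obtain ⟨j, k, rfl⟩ := hx
      rw [← Function.iterate_succ_apply' U (j + 1)]
      exact Submodule.subset_span ⟨j + 1, k, rfl⟩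
    | zero => simp
    | add x y _ _ hx hy => rw [map_add]; exact M.add_mem hx hy
    | smul c x _ hx => rw [map_smul]; exact M.smul_mem c hx
  -- Subtracting `m ∈ M` from `V k` leaves the pairing unchanged, because `U m` involves only powers
  -- from the second on. What remains lies in `L`, so only the projection of `V h` counts; the best
  -- approximation of `V k` by such `m` leaves `W k`.
  have hbound : ∀ h k : H, ‖inner ℂ (V h) (U (V k))‖ ≤ ‖L.starProjection (i (V h))‖ * ‖W k‖ := by
    intro h k
    have key : ∀ m ∈ M, ‖inner ℂ (V h) (U (V k))‖ ≤
        ‖L.starProjection (i (V h))‖ * ‖i (V k) - i m‖ := by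
      intro m hm
      have h1 : inner ℂ (V h) (U (V k)) = inner ℂ (i (V h)) (i (U (V k - m))) := by
        rw [i.inner_map_map, map_sub, inner_sub_right, hUM m hm, sub_zero]
      have h2 : i (U (V k - m)) ∈ L := by
        refine Submodule.le_topologicalClosure _ ⟨_, ?_, rfl⟩
        rw [map_sub]
        exact M.sub_mem (Submodule.subset_span ⟨0, k, rfl⟩) (hMU m hm)
      have h3 : inner ℂ (i (V h)) (i (U (V k - m))) =
          inner ℂ (L.starProjection (i (V h))) (i (U (V k - m))) := by
        rw [Submodule.inner_starProjection_left_eq_right, Submodule.starProjection_eq_self_iff.2 h2]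
      rw [h1, h3]
      refine (norm_inner_le_norm _ _).trans (le_of_eq ?_)
      rw [i.norm_map, U.norm_map, ← map_sub, i.norm_map]
    have hWk : W k = i (V k) - L.starProjection (i (V k)) := by
      rw [hW]
      exact eq_sub_of_add_eq' (L.starProjection_add_starProjection_orthogonal _)
    have hmem : L.starProjection (i (V k)) ∈ closure (i '' (M : Set E)) := by
      have := L.starProjection_apply_mem (i (V k))
      exact this
    have hcl : IsClosed {x : Completion E | ‖inner ℂ (V h) (U (V k))‖ ≤
        ‖L.starProjection (i (V h))‖ * ‖i (V k) - x‖} :=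
      isClosed_le continuous_const (by fun_prop)
    rw [hWk]
    refine closure_minimal ?_ hcl hmem
    rintro _ ⟨m, hm, rfl⟩
    exact key m hm
  refine ⟨W.adjoint ∘L W, ContinuousLinearMap.isPositive_adjoint_comp_self W, fun h k => ?_⟩
  rw [hA, hA, hpy h]
  have h1 := (Complex.abs_re_le_norm _).trans (hbound h k)
  have h2 := neg_le_of_abs_le h1
  nlinarith [sq_nonneg (‖L.starProjection (i (V h))‖ - ‖W k‖)]

/-! ### A model of the two isometries: functions weighted by `1 + Re(e^{it} X)`. -/

/-- The vector space of continuous functions from `ℝ` to `H`, without a topology. -/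
def ContFun (H : Type*) [NormedAddCommGroup H] : Type _ := C(ℝ, H)

instance {H : Type*} [NormedAddCommGroup H] : AddCommGroup (ContFun H) :=
  inferInstanceAs (AddCommGroup C(ℝ, H))

instance {H : Type*} [NormedAddCommGroup H] : FunLike (ContFun H) ℝ H :=
  inferInstanceAs (FunLike C(ℝ, H) ℝ H)

@[fun_prop]
theorem ContFun.continuous {H : Type*} [NormedAddCommGroup H] (f : ContFun H) : Continuous f :=
  ContinuousMap.continuous f

theorem ContFun.add_apply {H : Type*} [NormedAddCommGroup H] (f g : ContFun H) (t : ℝ) :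
    (f + g) t = f t + g t := rfl

variable {H : Type*} [NormedAddCommGroup H] [InnerProductSpace ℂ H]

instance : Module ℂ (ContFun H) := inferInstanceAs (Module ℂ C(ℝ, H))

namespace ContFun

theorem smul_apply (c : ℂ) (f : ContFun H) (t : ℝ) : (c • f) t = c • f t := rfl

/-- Multiplication by `e^{it}`. -/
def shift : ContFun H →ₗ[ℂ] ContFun H where
  toFun f := (⟨fun t => Complex.exp (t * Complex.I) • f t, by fun_prop⟩ : C(ℝ, H))
  map_add' f g := DFunLike.ext _ _ fun t => smul_add _ _ _
  map_smul' c f := DFunLike.ext _ _ fun t => smul_comm _ _ _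

theorem shift_apply (f : ContFun H) (t : ℝ) : shift f t = Complex.exp (t * Complex.I) • f t := rfl

theorem shift_iterate_apply (j : ℕ) (f : ContFun H) (t : ℝ) :
    shift^[j] f t = Complex.exp (j * (t * Complex.I)) • f t := by
  induction j with
  | zero => simp
  | succ j ih =>
    rw [Function.iterate_succ_apply', shift_apply, ih, smul_smul, ← Complex.exp_add]
    push_cast
    ring_nf

/-- The constant functions. -/
def const : H →ₗ[ℂ] ContFun H where
  toFun h := ContinuousMap.const ℝ h
  map_add' _ _ := rfl
  map_smul' _ _ := rfl

theorem const_apply (h : H) (t : ℝ) : (const h : ContFun H) t = h := rfl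

/-- The pointwise form `⟪f t, (1 + Re (e^{it} X)) g t⟫`. -/
def density (X : H →L[ℂ] H) (f g : ContFun H) (t : ℝ) : ℂ :=
  inner ℂ (f t) (g t) + (1 / 2) * (Complex.exp (t * Complex.I) * inner ℂ (f t) (X (g t)) +
    Complex.exp (-(t * Complex.I)) * inner ℂ (X (f t)) (g t))

@[fun_prop]
theorem continuous_density (X : H →L[ℂ] H) (f g : ContFun H) : Continuous (density X f g) := by
  unfold density
  fun_prop

theorem conj_exp_mul_I (t : ℝ) :
    conj (Complex.exp (t * Complex.I)) = Complex.exp (-(t * Complex.I)) := by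
  rw [← Complex.exp_conj]
  simp

theorem conj_density (X : H →L[ℂ] H) (f g : ContFun H) (t : ℝ) :
    conj (density X g f t) = density X f g t := by
  have h2 : conj (Complex.exp (-(t * Complex.I))) = Complex.exp (t * Complex.I) := by
    rw [← conj_exp_mul_I, Complex.conj_conj]
  simp only [density, map_add, map_mul, inner_conj_symm, conj_exp_mul_I, h2, map_div₀, map_one,
    map_ofNat]
  ring

theorem re_density_self_nonneg {X : H →L[ℂ] H} (hX : ∀ h, ‖inner ℂ h (X h)‖ ≤ ‖h‖ ^ 2)
    (f : ContFun H) (t : ℝ) : 0 ≤ (density X f f t).re := by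
  set z := Complex.exp (t * Complex.I) * inner ℂ (f t) (X (f t)) with hz
  have h1 : Complex.exp (-(t * Complex.I)) * inner ℂ (X (f t)) (f t) = conj z := by
    rw [hz, map_mul, conj_exp_mul_I, inner_conj_symm]
  have h2 : density X f f t = (‖f t‖ ^ 2 : ℝ) + (z.re : ℂ) := by
    rw [density, h1, ← hz, Complex.add_conj, inner_self_eq_norm_sq_to_K]
    push_cast
    rw [← mul_assoc, one_div_mul_cancel two_ne_zero, one_mul]
    rfl
  have h3 : ‖z‖ ≤ ‖f t‖ ^ 2 := by
    rw [hz, norm_mul, Complex.norm_exp_ofReal_mul_I, one_mul]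
    exact hX _
  have h4 := neg_le_of_abs_le ((Complex.abs_re_le_norm z).trans h3)
  rw [h2, ← Complex.ofReal_add, Complex.ofReal_re]
  linarith

/-- The mean of `density` over a period is a semi-inner product. -/
@[reducible]
def core {X : H →L[ℂ] H} (hX : ∀ h, ‖inner ℂ h (X h)‖ ≤ ‖h‖ ^ 2) :
    PreInnerProductSpace.Core ℂ (ContFun H) where
  inner f g := ∫ t in (-Real.pi)..Real.pi, (1 / (2 * Real.pi) : ℂ) * density X f g t
  conj_inner_symm f g := by
    rw [← intervalIntegral.intervalIntegral_conj]
    refine intervalIntegral.integral_congr fun t _ => ?_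
    simp only [map_mul, conj_density, map_div₀, map_one, map_ofNat, Complex.conj_ofReal]
  re_inner_nonneg f := by
    have h1 : (∫ t in (-Real.pi)..Real.pi, (1 / (2 * Real.pi) : ℂ) * density X f f t).re =
        ∫ t in (-Real.pi)..Real.pi, ((1 / (2 * Real.pi) : ℂ) * density X f f t).re := by
      refine (Complex.reCLM.intervalIntegral_comp_comm ?_).symm
      exact Continuous.intervalIntegrable (by fun_prop) _ _
    change 0 ≤ (∫ t in (-Real.pi)..Real.pi, (1 / (2 * Real.pi) : ℂ) * density X f f t).re
    rw [h1]
    refine intervalIntegral.integral_nonneg (by linarith [Real.pi_pos]) fun t _ => ?_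
    have h2 : (1 / (2 * Real.pi) : ℂ) = ((1 / (2 * Real.pi) : ℝ) : ℂ) := by push_cast; rfl
    rw [h2, Complex.re_ofReal_mul]
    have := re_density_self_nonneg hX f t
    have := Real.pi_pos
    positivity
  add_left f g k := by
    rw [← intervalIntegral.integral_add]
    · refine intervalIntegral.integral_congr fun t _ => ?_
      simp only [density, add_apply, inner_add_left, map_add]
      ring
    · exact Continuous.intervalIntegrable (by fun_prop) _ _
    · exact Continuous.intervalIntegrable (by fun_prop) _ _
  smul_left f g c := by
    rw [← intervalIntegral.integral_const_mul]
    refine intervalIntegral.integral_congr fun t _ => ?_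
    simp only [density, smul_apply, inner_smul_left, map_smul]
    ring

theorem core_inner {X : H →L[ℂ] H} (hX : ∀ h, ‖inner ℂ h (X h)‖ ≤ ‖h‖ ^ 2) (f g : ContFun H) :
    (core hX).inner f g = ∫ t in (-Real.pi)..Real.pi, (1 / (2 * Real.pi) : ℂ) * density X f g t :=
  rfl

theorem core_inner_shift {X : H →L[ℂ] H} (hX : ∀ h, ‖inner ℂ h (X h)‖ ≤ ‖h‖ ^ 2)
    (f g : ContFun H) : (core hX).inner (shift f) (shift g) = (core hX).inner f g := by
  rw [core_inner, core_inner]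
  refine intervalIntegral.integral_congr fun t _ => ?_
  have h1 : Complex.exp (t * Complex.I) * Complex.exp (-(t * Complex.I)) = 1 := by
    rw [← Complex.exp_add, add_neg_cancel, Complex.exp_zero]
  simp only [density, shift_apply, inner_smul_left, inner_smul_right, map_smul, conj_exp_mul_I]
  linear_combination (1 / (2 * Real.pi) : ℂ) * (inner ℂ (f t) (g t) +
    (1 / 2) * (Complex.exp (t * Complex.I) * inner ℂ (f t) (X (g t)) +
    Complex.exp (-(t * Complex.I)) * inner ℂ (X (f t)) (g t))) * h1

theorem integral_exp_int_mul {n : ℤ} (hn : n ≠ 0) :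
    ∫ t in (-Real.pi)..Real.pi, Complex.exp (n * (t * Complex.I)) = 0 := by
  have hc : (n * Complex.I : ℂ) ≠ 0 := mul_ne_zero (Int.cast_ne_zero.2 hn) Complex.I_ne_zero
  have h1 : ∀ t : ℝ, Complex.exp (n * (t * Complex.I)) = Complex.exp (n * Complex.I * t) :=
    fun t => by ring_nf
  simp only [h1]
  rw [integral_exp_mul_complex hc]
  have h2 : Complex.exp (n * Complex.I * (Real.pi : ℝ)) =
      Complex.exp (n * Complex.I * (-Real.pi : ℝ)) := by
    refine Complex.exp_eq_exp_iff_exists_int.2 ⟨n, ?_⟩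
    push_cast
    ring
  rw [h2, sub_self, zero_div]

/-- The weight has only the frequencies `-1, 0, 1`, so the integral picks out a Fourier coefficient.
As `j ≥ 0`, the term in `X k` has frequency `j + 1 ≠ 0` and never survives. -/
theorem core_inner_const_shift {X : H →L[ℂ] H} (hX : ∀ h, ‖inner ℂ h (X h)‖ ≤ ‖h‖ ^ 2)
    (j : ℕ) (h k : H) : (core hX).inner (const h) (shift^[j] (const k)) =
      if j = 0 then inner ℂ h k else if j = 1 then (1 / 2) * inner ℂ (X h) k else 0 := by
  have hI : ∀ n : ℤ, IntervalIntegrable (fun t : ℝ => Complex.exp (n * (t * Complex.I)))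
      MeasureTheory.volume (-Real.pi) Real.pi :=
    fun n => Continuous.intervalIntegrable (by fun_prop) _ _
  have hval : ∀ n : ℤ, ∫ t in (-Real.pi)..Real.pi, Complex.exp (n * (t * Complex.I)) =
      if n = 0 then (2 * Real.pi : ℂ) else 0 := by
    intro n
    split_ifs with hn
    · subst hn
      simp
      ring
    · exact integral_exp_int_mul hn
  have hpi : (Real.pi : ℂ) ≠ 0 := Complex.ofReal_ne_zero.2 Real.pi_ne_zero
  have h1 : (core hX).inner (const h) (shift^[j] (const k)) =
      ∫ t in (-Real.pi)..Real.pi,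
        ((1 / (2 * Real.pi) * inner ℂ h k : ℂ) * Complex.exp ((j : ℤ) * (t * Complex.I)) +
        (1 / (2 * Real.pi) * (1 / 2) * inner ℂ h (X k) : ℂ) *
          Complex.exp ((j + 1 : ℤ) * (t * Complex.I)) +
        (1 / (2 * Real.pi) * (1 / 2) * inner ℂ (X h) k : ℂ) *
          Complex.exp ((j - 1 : ℤ) * (t * Complex.I))) := by
    rw [core_inner]
    refine intervalIntegral.integral_congr fun t _ => ?_
    have e1 : Complex.exp ((j + 1 : ℤ) * (t * Complex.I)) =
        Complex.exp (t * Complex.I) * Complex.exp (j * (t * Complex.I)) := by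
      rw [← Complex.exp_add]; push_cast; ring_nf
    have e2 : Complex.exp ((j - 1 : ℤ) * (t * Complex.I)) =
        Complex.exp (-(t * Complex.I)) * Complex.exp (j * (t * Complex.I)) := by
      rw [← Complex.exp_add]; push_cast; ring_nf
    simp only [density, shift_iterate_apply, const_apply, inner_smul_right, map_smul]
    push_cast at e1 e2 ⊢
    rw [e1, e2]
    ring
  have hJ : ∀ (n : ℤ) (c : ℂ), IntervalIntegrable
      (fun t : ℝ => c * Complex.exp (n * (t * Complex.I)))
      MeasureTheory.volume (-Real.pi) Real.pi := fun n c => (hI n).const_mul c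
  rw [h1, intervalIntegral.integral_add ((hJ _ _).add (hJ _ _)) (hJ _ _),
    intervalIntegral.integral_add (hJ _ _) (hJ _ _)]
  simp only [intervalIntegral.integral_const_mul, hval]
  rcases j with _ | _ | j
  · norm_num
    field_simp
  · norm_num
    field_simp
  · have a1 : ((j + 1 + 1 : ℕ) : ℤ) ≠ 0 := by omega
    have a2 : ((j + 1 + 1 : ℕ) : ℤ) + 1 ≠ 0 := by omega
    have a3 : ((j + 1 + 1 : ℕ) : ℤ) - 1 ≠ 0 := by omega
    rw [if_neg a1, if_neg a2, if_neg a3]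
    simp

end ContFun

/-- **Ando's theorem**: if the numerical radius of `X` is at most one, then there is a positive
operator `A` such that `[[1 - A, X† / 2], [X / 2, A]]` is positive. -/
theorem exists_isPositive_of_numericalRadius_le_one [CompleteSpace H] {X : H →L[ℂ] H}
    (hX : ∀ h, ‖inner ℂ h (X h)‖ ≤ ‖h‖ ^ 2) :
    ∃ A : H →L[ℂ] H, A.IsPositive ∧ ∀ h k : H,
      0 ≤ ‖h‖ ^ 2 - (inner ℂ h (A h)).re + (inner ℂ (X h) k).re + (inner ℂ k (A k)).re := by
  -- The form may be degenerate, so it gives only a seminorm; separation and completeness come from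
  -- the completion used in `exists_isPositive_of_isometry`.
  let c := ContFun.core hX
  let _ : SeminormedAddCommGroup (ContFun H) :=
    @InnerProductSpace.Core.toSeminormedAddCommGroup ℂ (ContFun H) _ _ _ c
  let _ : InnerProductSpace ℂ (ContFun H) := InnerProductSpace.ofCore c
  let U : ContFun H →ₗᵢ[ℂ] ContFun H := LinearMap.isometryOfInner ContFun.shift
    fun f g => ContFun.core_inner_shift hX f g
  let V : H →ₗᵢ[ℂ] ContFun H := LinearMap.isometryOfInner ContFun.const
    fun h k => (ContFun.core_inner_const_shift hX 0 h k).trans (if_pos rfl)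
  have h1 : ∀ h k, inner ℂ (V h) (U (V k)) = (1 / 2) * inner ℂ (X h) k := fun h k =>
    (ContFun.core_inner_const_shift hX 1 h k).trans (by simp)
  obtain ⟨A, hA, hAX⟩ := exists_isPositive_of_isometry U V fun j h k =>
    (ContFun.core_inner_const_shift hX (j + 2) h k).trans (by simp)
  refine ⟨A, hA, fun h k => ?_⟩
  have h2 := hAX h k
  rw [h1] at h2
  have h3 : ((1 / 2 : ℂ) * inner ℂ (X h) k).re = (1 / 2) * (inner ℂ (X h) k).re := by
    rw [show (1 / 2 : ℂ) = ((1 / 2 : ℝ) : ℂ) by norm_num, Complex.re_ofReal_mul]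
  rw [h3] at h2
  linarith

end Ando

/-! ### The ellipse, stability of powers, and the companion operator. -/

open Filter Topology ComplexConjugate

/-- For `z = x + iy` one has `z - δ z̄ = (1 - δ)x + i(1 + δ)y`. -/
theorem mem_ellipse_iff {δ : ℝ} (hδ : δ ∈ Set.Ioo (0 : ℝ) 1) (z : ℂ) :
    z ∈ ellipse δ ↔ ‖z - δ * conj z‖ ≤ 1 - δ ^ 2 := by
  obtain ⟨h0, h1⟩ := hδ
  have ha : 0 < 1 + δ := by linarith
  have hb : 0 < 1 - δ := by linarith
  have hc : 0 ≤ 1 - δ ^ 2 := by nlinarith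
  rw [← abs_of_nonneg hc, ← abs_of_nonneg (norm_nonneg (z - δ * conj z)), ← sq_le_sq,
    Complex.sq_norm, Complex.normSq_apply]
  simp only [ellipse, Set.mem_ofPred_eq, Complex.sub_re, Complex.sub_im, Complex.re_ofReal_mul,
    Complex.im_ofReal_mul, Complex.conj_re, Complex.conj_im]
  rw [div_add_div _ _ (by positivity) (by positivity), div_le_one (by positivity)]
  ring_nf

/-- A root of `μ² - r w μ + δ` lies in the open unit disc if `w` is in the ellipse and `r < 1`. -/
theorem norm_lt_one_of_mem_ellipse {δ r : ℝ} (hδ : δ ∈ Set.Ioo (0 : ℝ) 1)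
    (hr : r ∈ Set.Ioo (0 : ℝ) 1) {w μ : ℂ} (hw : w ∈ ellipse δ) (h : r * w * μ = μ ^ 2 + δ) :
    ‖μ‖ < 1 := by
  rw [mem_ellipse_iff hδ] at hw
  obtain ⟨h0, h1⟩ := hδ
  by_contra! hμ
  set s := ‖μ‖ ^ 2 with hs
  have hs1 : 1 ≤ s := one_le_pow₀ hμ
  have hmul : (μ : ℂ) * conj μ = s := by rw [Complex.mul_conj, Complex.normSq_eq_norm_sq]
  have hsc : 0 < s := by linarith
  -- Substitute `r w = μ + δ / μ` and clear denominators by `s = μ μ̄`.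
  have key : ((r * s : ℝ) : ℂ) * (w - δ * conj w) =
      ((s - δ ^ 2 : ℝ) : ℂ) * μ - ((δ * (s - 1) : ℝ) : ℂ) * conj μ := by
    have h' := congrArg conj h
    simp only [map_mul, map_add, map_pow, Complex.conj_ofReal] at h'
    push_cast
    linear_combination (conj μ) * h - δ * μ * h' + (-r * w + r * δ * conj w + μ - δ * conj μ) * hmul
  have hn : r * s * ‖w - δ * conj w‖ ≥ (s - δ ^ 2) * ‖μ‖ - δ * (s - 1) * ‖μ‖ := by
    have h2 := norm_sub_norm_le (((s - δ ^ 2 : ℝ) : ℂ) * μ) (((δ * (s - 1) : ℝ) : ℂ) * conj μ)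
    rw [← key, norm_mul, norm_mul, norm_mul, Complex.norm_real, Complex.norm_real,
      Complex.norm_real, Complex.norm_conj, Real.norm_of_nonneg (mul_nonneg hr.1.le hsc.le),
      Real.norm_of_nonneg (by nlinarith : 0 ≤ s - δ ^ 2),
      Real.norm_of_nonneg (mul_nonneg h0.le (by linarith))] at h2
    exact h2
  have hc : 0 < 1 - δ ^ 2 := by nlinarith
  have h2 : r * s * ‖w - δ * conj w‖ ≤ r * s * (1 - δ ^ 2) :=
    mul_le_mul_of_nonneg_left hw (mul_nonneg hr.1.le hsc.le)
  have h3 : r * (s * (1 - δ ^ 2)) < 1 * (s * (1 - δ ^ 2)) :=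
    mul_lt_mul_of_pos_right hr.2 (by positivity)
  have h4 : 0 ≤ (1 - δ) * ‖μ‖ * ((‖μ‖ - 1) * (‖μ‖ - δ)) := by
    refine mul_nonneg (mul_nonneg (by linarith) (norm_nonneg _)) (mul_nonneg ?_ ?_) <;> linarith
  have h5 : (1 - δ) * ‖μ‖ * ((‖μ‖ - 1) * (‖μ‖ - δ)) =
      (s - δ ^ 2) * ‖μ‖ - δ * (s - 1) * ‖μ‖ - s * (1 - δ ^ 2) := by
    rw [hs]; ring
  linarith

/-- In finite dimension every point of the spectrum is an eigenvalue. -/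
theorem exists_eigenvector_of_mem_spectrum {E : Type*} [NormedAddCommGroup E] [NormedSpace ℂ E]
    [FiniteDimensional ℂ E] {M : E →L[ℂ] E} {μ : ℂ} (hμ : μ ∈ spectrum ℂ M) :
    ∃ v, v ≠ 0 ∧ M v = μ • v := by
  have := FiniteDimensional.complete ℂ E
  by_contra! hne
  refine hμ (spectrum.mem_resolventSet_iff.2 ?_)
  rw [ContinuousLinearMap.isUnit_iff_bijective]
  have hinj : Function.Injective (algebraMap ℂ (E →L[ℂ] E) μ - M) := by
    rw [injective_iff_map_eq_zero]
    intro v hv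
    by_contra hv0
    refine hne v hv0 ?_
    rw [sub_apply, sub_eq_zero] at hv
    rw [← hv, Algebra.algebraMap_eq_smul_one]
    rfl
  exact ⟨hinj, (LinearMap.injective_iff_surjective (f := (algebraMap ℂ (E →L[ℂ] E) μ - M :
    E →L[ℂ] E).toLinearMap)).1 hinj⟩

theorem mem_spectrum_of_eigenvector {E : Type*} [NormedAddCommGroup E] [NormedSpace ℂ E]
    {M : E →L[ℂ] E} {μ : ℂ} {v : E} (hv : v ≠ 0) (h : M v = μ • v) : μ ∈ spectrum ℂ M := by
  intro hu
  obtain ⟨u, hu⟩ := hu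
  have h1 : (u : E →L[ℂ] E) v = 0 := by
    rw [hu, sub_apply, h, Algebra.algebraMap_eq_smul_one]
    simp
  refine hv ?_
  calc v = ((↑u⁻¹ : E →L[ℂ] E) * u) v := by rw [u.inv_mul]; rfl
    _ = (↑u⁻¹ : E →L[ℂ] E) ((u : E →L[ℂ] E) v) := rfl
    _ = 0 := by rw [h1, map_zero]

/-- Gelfand's formula bounds `‖M ^ n‖` eventually by `c ^ n` for some `c < 1`. -/
theorem tendsto_pow_apply_of_spectrum {E : Type*} [NormedAddCommGroup E] [NormedSpace ℂ E]
    [CompleteSpace E] {M : E →L[ℂ] E} (hM : ∀ μ ∈ spectrum ℂ M, ‖μ‖ < 1) (v : E) :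
    Tendsto (fun n : ℕ => (M ^ n) v) atTop (𝓝 0) := by
  rcases subsingleton_or_nontrivial E with hE | hE
  · rw [show (fun n : ℕ => (M ^ n) v) = fun _ => 0 from funext fun n => Subsingleton.elim _ _]
    exact tendsto_const_nhds
  have hr : spectralRadius ℂ M < (1 : NNReal) :=
    spectrum.spectralRadius_lt_of_forall_lt M fun μ hμ => by
      have := hM μ hμ
      rw [← NNReal.coe_lt_coe]
      exact_mod_cast this
  obtain ⟨c, hc1, hc2⟩ := ENNReal.lt_iff_exists_nnreal_btwn.1 hr
  have hev := (spectrum.pow_nnnorm_pow_one_div_tendsto_nhds_spectralRadius M).eventually_lt_const hc1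
  have hc3 : c < 1 := by exact_mod_cast hc2
  have hpow : Tendsto (fun n : ℕ => (c : ℝ) ^ n * ‖v‖) atTop (𝓝 0) := by
    simpa using (tendsto_pow_atTop_nhds_zero_of_lt_one c.2 hc3).mul_const ‖v‖
  refine squeeze_zero_norm' ?_ hpow
  filter_upwards [hev, eventually_gt_atTop 0] with n hn hn0
  have h1 : ‖M ^ n‖₊ ≤ c ^ n := by
    have h2 := ENNReal.rpow_le_rpow hn.le (Nat.cast_nonneg n : (0 : ℝ) ≤ n)
    rw [← ENNReal.rpow_mul, one_div_mul_cancel (Nat.cast_ne_zero.2 hn0.ne'), ENNReal.rpow_one,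
      ENNReal.rpow_natCast] at h2
    exact_mod_cast h2
  refine ((M ^ n).le_opNorm v).trans ?_
  gcongr
  exact_mod_cast h1

/-- A Lyapunov argument: `F` does not increase along an orbit that tends to `0`, where `F` vanishes.
-/
theorem nonneg_of_apply_le {E : Type*} [NormedAddCommGroup E] [NormedSpace ℂ E]
    [CompleteSpace E] {M : E →L[ℂ] E} (hM : ∀ μ ∈ spectrum ℂ M, ‖μ‖ < 1) {F : E → ℝ}
    (hF : Continuous F) (hF0 : F 0 = 0) (h : ∀ v, F (M v) ≤ F v) (v : E) : 0 ≤ F v := by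
  have h1 : ∀ n : ℕ, F ((M ^ n) v) ≤ F v := by
    intro n
    induction n with
    | zero => rfl
    | succ n ih =>
      rw [pow_succ']
      exact (h _).trans ih
  have h2 := (hF.tendsto 0).comp (tendsto_pow_apply_of_spectrum hM v)
  rw [hF0] at h2
  exact le_of_tendsto h2 (Eventually.of_forall h1)

variable {H : Type*} [NormedAddCommGroup H] [InnerProductSpace ℂ H]

theorem inner_apply_eq_of_numericalRange_subset {δ : ℝ} {T : H →L[ℂ] H}
    (hT : numericalRange T ⊆ ellipse δ) {h : H} (hh : h ≠ 0) :
    ∃ w ∈ ellipse δ, inner ℂ h (T h) = w * (‖h‖ ^ 2 : ℝ) := by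
  have hn : (‖h‖ : ℂ) ≠ 0 := Complex.ofReal_ne_zero.2 (norm_ne_zero_iff.2 hh)
  refine ⟨_, hT ⟨((‖h‖ : ℂ)⁻¹) • h, ?_, rfl⟩, ?_⟩
  · rw [norm_smul, norm_inv, Complex.norm_real, norm_norm]
    exact inv_mul_cancel₀ (norm_ne_zero_iff.2 hh)
  · rw [map_smul, inner_smul_left, inner_smul_right, map_inv₀, Complex.conj_ofReal]
    push_cast
    field_simp

/-- The operator `[[T, δ], [-1, 0]]`, whose eigenvalues are the solutions of `μ + δ / μ ∈ σ(T)`. -/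
def companion (δ : ℝ) (T : H →L[ℂ] H) : H × H →L[ℂ] H × H :=
  (T.coprod ((δ : ℂ) • ContinuousLinearMap.id ℂ H)).prod (-ContinuousLinearMap.fst ℂ H H)

theorem companion_apply (δ : ℝ) (T : H →L[ℂ] H) (h k : H) :
    companion δ T (h, k) = (T h + (δ : ℂ) • k, -h) := rfl

theorem norm_lt_one_of_mem_spectrum_companion [FiniteDimensional ℂ H] {δ r : ℝ}
    (hδ : δ ∈ Set.Ioo (0 : ℝ) 1) (hr : r ∈ Set.Ioo (0 : ℝ) 1) {T : H →L[ℂ] H}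
    (hT : numericalRange T ⊆ ellipse δ) {μ : ℂ}
    (hμ : μ ∈ spectrum ℂ (companion δ ((r : ℂ) • T))) : ‖μ‖ < 1 := by
  obtain ⟨⟨h, k⟩, hv, hM⟩ := exists_eigenvector_of_mem_spectrum hμ
  rw [companion_apply, Prod.smul_mk, Prod.mk.injEq] at hM
  obtain ⟨h1, h2⟩ := hM
  have h3 : h = -(μ • k) := by rw [← h2, neg_neg]
  have hk : k ≠ 0 := by
    rintro rfl
    exact hv (by rw [h3, smul_zero, neg_zero]; rfl)
  -- The Rayleigh quotient `w` of `T` at `k` satisfies `r w μ = μ² + δ`.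
  obtain ⟨w, hw, hwk⟩ := inner_apply_eq_of_numericalRange_subset hT hk
  refine norm_lt_one_of_mem_ellipse hδ hr hw ?_
  have h4 := congrArg (inner ℂ k) h1
  rw [h3] at h4
  simp only [smul_apply, map_neg, map_smul, inner_add_right, inner_smul_right,
    inner_neg_right, hwk, smul_neg] at h4
  rw [inner_self_eq_norm_sq_to_K] at h4
  have hn : (‖k‖ : ℂ) ^ 2 ≠ 0 := pow_ne_zero 2 (Complex.ofReal_ne_zero.2 (norm_ne_zero_iff.2 hk))
  refine mul_right_cancel₀ hn ?_
  simp only [Complex.coe_algebraMap, Complex.ofReal_pow] at h4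
  linear_combination -h4

theorem norm_add_sq_complex (x y : H) :
    ‖x + y‖ ^ 2 = ‖x‖ ^ 2 + 2 * (inner ℂ x y).re + ‖y‖ ^ 2 := norm_add_sq (𝕜 := ℂ) x y

theorem norm_real_smul_sq (c : ℝ) (x : H) : ‖(c : ℂ) • x‖ ^ 2 = c ^ 2 * ‖x‖ ^ 2 := by
  rw [norm_smul, mul_pow, Complex.norm_real, Real.norm_eq_abs, sq_abs]

theorem re_inner_real_smul_left (c : ℝ) (x y : H) :
    (inner ℂ ((c : ℂ) • x) y).re = c * (inner ℂ x y).re := by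
  rw [inner_smul_left, Complex.conj_ofReal, Complex.re_ofReal_mul]

theorem re_inner_real_smul_right (c : ℝ) (x y : H) :
    (inner ℂ x ((c : ℂ) • y)).re = c * (inner ℂ x y).re := by
  rw [inner_smul_right, Complex.re_ofReal_mul]

theorem re_inner_comm (x y : H) : (inner ℂ x y).re = (inner ℂ y x).re := inner_re_symm (𝕜 := ℂ) x y

/-! ### A positive form that decreases under the companion operator. -/

/-- If `W(T)` lies in the ellipse and `q` is a quadratic form that satisfies the inequality
characterizing this, then `q` dominates the form of `T† T / 4`. -/
theorem norm_apply_sq_le [FiniteDimensional ℂ H] {δ : ℝ} (hδ : δ ∈ Set.Ioo (0 : ℝ) 1)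
    {T : H →L[ℂ] H} (hT : numericalRange T ⊆ ellipse δ) {q : H → ℝ} (hq : Continuous q)
    (hq0 : q 0 = 0) (hqn : ∀ h, q (-h) = q h)
    (hqT : ∀ h k : H, q h + δ ^ 2 * ‖k‖ ^ 2 + δ * (inner ℂ (T h) k).re ≤
      ‖h‖ ^ 2 + q k + (inner ℂ h (T k)).re) (k : H) : ‖T k‖ ^ 2 ≤ 4 * q k := by
  have := FiniteDimensional.complete ℂ H
  have key : ∀ r ∈ Set.Ioo (0 : ℝ) 1, r ^ 2 * ‖T k‖ ^ 2 ≤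
      4 * (r * q k + (1 - r) * ((1 + δ ^ 2) / 2) * ‖k‖ ^ 2) := by
    intro r hr
    -- The inequality for `rT` is a convex combination of the one for `T` with form `q` and the one
    -- for the zero operator, for which `(1 + δ²)/2 · ‖·‖²` is admissible.
    let F : H × H → ℝ := fun v => ‖v.1‖ ^ 2 +
      (r * q v.2 + (1 - r) * ((1 + δ ^ 2) / 2) * ‖v.2‖ ^ 2) + r * (inner ℂ v.1 (T v.2)).re
    have hF : Continuous F := by
      have h1 : Continuous fun v : H × H => q v.2 := hq.comp continuous_snd
      have h2 : Continuous fun v : H × H => (inner ℂ v.1 (T v.2)).re :=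
        Complex.continuous_re.comp (by fun_prop)
      fun_prop
    have hle : ∀ v, F (companion δ ((r : ℂ) • T) v) ≤ F v := by
      rintro ⟨h, k⟩
      have h1 := mul_le_mul_of_nonneg_left (hqT h k) hr.1.le
      have h2 : 0 ≤ (1 - r) * ((1 - δ ^ 2) * (‖h‖ ^ 2 + ‖k‖ ^ 2)) := by
        have : 0 ≤ 1 - r := by linarith [hr.2]
        have : 0 ≤ 1 - δ ^ 2 := by nlinarith [hδ.1, hδ.2]
        positivity
      simp only [F, companion_apply, smul_apply, norm_neg, hqn, map_neg,
        inner_neg_right, Complex.neg_re, norm_add_sq_complex, norm_real_smul_sq, inner_add_left,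
        Complex.add_re, re_inner_real_smul_left, re_inner_real_smul_right]
      rw [re_inner_comm k (T h)]
      have h3 : (inner ℂ (T h) (T h)).re = ‖T h‖ ^ 2 := inner_self_eq_norm_sq (𝕜 := ℂ) _
      rw [h3]
      linarith
    -- The first component `-(r/2) T k` minimizes `F` for fixed `k`.
    have h0 := nonneg_of_apply_le (fun μ hμ => norm_lt_one_of_mem_spectrum_companion hδ hr hT hμ)
      hF (by simp [F, hq0]) hle (((-(r / 2) : ℝ) : ℂ) • T k, k)
    simp only [F, norm_real_smul_sq, re_inner_real_smul_left] at h0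
    have h3 : (inner ℂ (T k) (T k)).re = ‖T k‖ ^ 2 := inner_self_eq_norm_sq (𝕜 := ℂ) _
    rw [h3] at h0
    nlinarith
  have hcl : (1 : ℝ) ∈ closure (Set.Ioo (0 : ℝ) 1) := by
    rw [closure_Ioo zero_ne_one]
    exact ⟨zero_le_one, le_rfl⟩
  have h1 := closure_minimal (s := Set.Ioo (0 : ℝ) 1) (t := {r : ℝ | r ^ 2 * ‖T k‖ ^ 2 ≤
      4 * (r * q k + (1 - r) * ((1 + δ ^ 2) / 2) * ‖k‖ ^ 2)})
    (fun r hr => Set.mem_ofPred_eq.symm ▸ key r hr)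
    (isClosed_le (by fun_prop) (by fun_prop)) hcl
  simpa using h1

/-- If `W(T)` lies in the ellipse, then the form `‖h + T k / 2‖² + ⟪k, D k⟫ / 4` decreases under
`companion δ T`, for some positive operator `D`. -/
theorem exists_isPositive_of_numericalRange_subset [FiniteDimensional ℂ H] {δ : ℝ}
    (hδ : δ ∈ Set.Ioo (0 : ℝ) 1) {T : H →L[ℂ] H} (hT : numericalRange T ⊆ ellipse δ)
    [CompleteSpace H] :
    ∃ D : H →L[ℂ] H, D.IsPositive ∧ ∀ h k : H,
      ‖((1 / 2 : ℝ) : ℂ) • T h + (δ : ℂ) • k‖ ^ 2 + (1 / 4) * (inner ℂ h (D h)).re ≤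
        ‖h + ((1 / 2 : ℝ) : ℂ) • T k‖ ^ 2 + (1 / 4) * (inner ℂ k (D k)).re := by
  have hδ2 : 0 < 1 - δ ^ 2 := by nlinarith [hδ.1, hδ.2]
  let X : H →L[ℂ] H := (((1 - δ ^ 2)⁻¹ : ℝ) : ℂ) • (T - (δ : ℂ) • T.adjoint)
  have hX : ∀ h, ‖inner ℂ h (X h)‖ ≤ ‖h‖ ^ 2 := by
    intro h
    rcases eq_or_ne h 0 with rfl | hh
    · simp
    obtain ⟨w, hw, hwh⟩ := inner_apply_eq_of_numericalRange_subset hT hh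
    rw [mem_ellipse_iff hδ] at hw
    have h1 : inner ℂ h (T.adjoint h) = conj w * (‖h‖ ^ 2 : ℝ) := by
      rw [ContinuousLinearMap.adjoint_inner_right, ← inner_conj_symm, hwh, map_mul,
        Complex.conj_ofReal]
    have h2 : inner ℂ h (X h) =
        (((1 - δ ^ 2)⁻¹ : ℝ) : ℂ) * ((w - δ * conj w) * (‖h‖ ^ 2 : ℝ)) := by
      simp only [X, smul_apply, sub_apply,
        inner_smul_right, inner_sub_right, hwh, h1]
      ring
    rw [h2, norm_mul, norm_mul, Complex.norm_real, Complex.norm_real,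
      Real.norm_of_nonneg (inv_nonneg.2 hδ2.le), Real.norm_of_nonneg (sq_nonneg _), ← mul_assoc]
    refine mul_le_of_le_one_left (sq_nonneg _) ?_
    rw [inv_mul_le_iff₀ hδ2, mul_one]
    exact hw
  obtain ⟨A, hA, hAX⟩ := exists_isPositive_of_numericalRadius_le_one hX
  -- With this `q`, Ando's inequality at `(k, h)`, multiplied by `1 - δ²`, becomes `hqT`.
  let q : H → ℝ := fun h => ‖h‖ ^ 2 - (1 - δ ^ 2) * (inner ℂ h (A h)).re
  have hqT : ∀ h k : H, q h + δ ^ 2 * ‖k‖ ^ 2 + δ * (inner ℂ (T h) k).re ≤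
      ‖h‖ ^ 2 + q k + (inner ℂ h (T k)).re := by
    intro h k
    have h1 := mul_le_mul_of_nonneg_left (hAX k h) hδ2.le
    have h2 : (inner ℂ (X k) h).re = (1 - δ ^ 2)⁻¹ *
        ((inner ℂ h (T k)).re - δ * (inner ℂ (T h) k).re) := by
      simp only [X, smul_apply, sub_apply,
        re_inner_real_smul_left, inner_sub_left, Complex.sub_re]
      rw [ContinuousLinearMap.adjoint_inner_left, re_inner_comm (T k), re_inner_comm k]
    have h3 : (1 - δ ^ 2) * (inner ℂ (X k) h).re =
        (inner ℂ h (T k)).re - δ * (inner ℂ (T h) k).re := by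
      rw [h2, mul_inv_cancel_left₀ hδ2.ne']
    simp only [q]
    linarith
  have hqc : Continuous q := by
    have h2 : Continuous fun v : H => (inner ℂ v (A v)).re :=
      Complex.continuous_re.comp (by fun_prop)
    fun_prop
  have hpos := norm_apply_sq_le hδ hT hqc (by simp [q]) (by simp [q]) hqT
  let D : H →L[ℂ] H := (4 : ℂ) • (1 : H →L[ℂ] H) - ((4 * (1 - δ ^ 2) : ℝ) : ℂ) • A -
    T.adjoint ∘L T
  have hD : ∀ h, (inner ℂ h (D h)).re = 4 * q h - ‖T h‖ ^ 2 := by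
    intro h
    simp only [D, q, sub_apply, smul_apply,
      one_apply_eq_self, ContinuousLinearMap.comp_apply, inner_sub_right,
      ContinuousLinearMap.adjoint_inner_right, Complex.sub_re, re_inner_real_smul_right]
    have h1 : (inner ℂ (T h) (T h)).re = ‖T h‖ ^ 2 := inner_self_eq_norm_sq (𝕜 := ℂ) _
    have h2 : (inner ℂ h h).re = ‖h‖ ^ 2 := inner_self_eq_norm_sq (𝕜 := ℂ) _
    have h3 : (4 : ℂ) = ((4 : ℝ) : ℂ) := by norm_num
    rw [h3, re_inner_real_smul_right, h1, h2]
    ring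
  have hDs : IsSelfAdjoint D := by
    refine IsSelfAdjoint.sub (IsSelfAdjoint.sub ?_ ?_) ?_
    · exact IsSelfAdjoint.smul (by simp [IsSelfAdjoint]) (.one _)
    · exact IsSelfAdjoint.smul (by simp [IsSelfAdjoint]) hA.isSelfAdjoint
    · exact (ContinuousLinearMap.isPositive_adjoint_comp_self T).isSelfAdjoint
  refine ⟨D, ?_, fun h k => ?_⟩
  · rw [ContinuousLinearMap.isPositive_def']
    refine ⟨hDs, fun h => ?_⟩
    change 0 ≤ (inner ℂ (D h) h).re
    rw [re_inner_comm, hD]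
    linarith [hpos h]
  · have h1 := hqT h k
    simp only [hD, norm_add_sq_complex, norm_real_smul_sq, re_inner_real_smul_left,
      re_inner_real_smul_right]
    linarith

/-! ### Conjugates of `Z_T` and their germinator properties. -/

theorem unit_apply_inv (u : (H →L[ℂ] H)ˣ) (x : H) :
    (u : H →L[ℂ] H) ((↑u⁻¹ : H →L[ℂ] H) x) = x := by
  rw [← mul_apply_eq_comp, u.mul_inv]; rfl

theorem unit_inv_apply (u : (H →L[ℂ] H)ˣ) (x : H) :
    (↑u⁻¹ : H →L[ℂ] H) ((u : H →L[ℂ] H) x) = x := by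
  rw [← mul_apply_eq_comp, u.inv_mul]; rfl

theorem isUnit_of_injective [FiniteDimensional ℂ H] {R : H →L[ℂ] H}
    (hR : ∀ x, R x = 0 → x = 0) : IsUnit R := by
  have := FiniteDimensional.complete ℂ H
  have hinj : Function.Injective R := (injective_iff_map_eq_zero R).2 hR
  rw [ContinuousLinearMap.isUnit_iff_bijective]
  exact ⟨hinj, (LinearMap.injective_iff_surjective (f := R.toLinearMap)).1 hinj⟩

theorem inverse_diagOne (u : (H →L[ℂ] H)ˣ) :
    Ring.inverse (diagOne (u : H →L[ℂ] H)) = diagOne (↑u⁻¹ : H →L[ℂ] H) := by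
  have h1 : ∀ A B : H →L[ℂ] H, diagOne A * diagOne B = diagOne (A * B) := by
    intro A B
    ext1 v
    obtain ⟨x, y⟩ := v
    simp [diagOne, blockOp_apply]
  have h2 : diagOne (1 : H →L[ℂ] H) = 1 := by
    ext1 v
    obtain ⟨x, y⟩ := v
    simp [diagOne, blockOp_apply]
  let U : (DSum H →L[ℂ] DSum H)ˣ := ⟨diagOne u, diagOne (↑u⁻¹ : H →L[ℂ] H),
    by rw [h1, u.mul_inv, h2], by rw [h1, u.inv_mul, h2]⟩
  exact Ring.inverse_unit U

/-- The operator `diag(1, u) Z_T diag(1, u)⁻¹`. -/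
def conjZ (T Q : H →L[ℂ] H) (u : (H →L[ℂ] H)ˣ) : DSum H →L[ℂ] DSum H :=
  diagOne (u : H →L[ℂ] H) * opZ T Q * Ring.inverse (diagOne (u : H →L[ℂ] H))

theorem conjZ_apply (T Q : H →L[ℂ] H) (u : (H →L[ℂ] H)ˣ) (x y : H) :
    conjZ T Q u (WithLp.toLp 2 (x, y)) =
      WithLp.toLp 2 ((1 / 2 : ℂ) • (T x + Q ((↑u⁻¹ : H →L[ℂ] H) y)),
        (1 / 2 : ℂ) • (u : H →L[ℂ] H) (Q x + T ((↑u⁻¹ : H →L[ℂ] H) y))) := by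
  rw [conjZ, inverse_diagOne]
  simp [diagOne, opZ, blockOp_apply, ← WithLp.toLp_smul]

theorem symJ_apply (x y : H) : symJ (WithLp.toLp 2 (x, y)) = WithLp.toLp 2 (x, -y) := by
  simp [symJ, blockOp_apply]

theorem symJ_conjZ_symJ_apply (T Q : H →L[ℂ] H) (u : (H →L[ℂ] H)ˣ) (x y : H) :
    (symJ * conjZ T Q u * symJ : DSum H →L[ℂ] DSum H) (WithLp.toLp 2 (x, y)) =
      WithLp.toLp 2 ((1 / 2 : ℂ) • (T x - Q ((↑u⁻¹ : H →L[ℂ] H) y)),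
        (1 / 2 : ℂ) • (u : H →L[ℂ] H) (T ((↑u⁻¹ : H →L[ℂ] H) y) - Q x)) := by
  rw [mul_apply_eq_comp, mul_apply_eq_comp, symJ_apply, conjZ_apply, symJ_apply, map_neg, map_neg,
    map_neg, ← sub_eq_add_neg, ← sub_eq_add_neg, ← smul_neg, ← map_neg, neg_sub]

theorem IsRoot.apply_apply {δ : ℝ} {T Q : H →L[ℂ] H} (h : IsRoot δ T Q) (x : H) :
    Q (Q x) = T (T x) - (4 * δ : ℂ) • x := by
  have h1 := congrArg (fun A : H →L[ℂ] H => A x) h.sq_eq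
  simp only [pow_two] at h1
  simpa using h1

theorem IsRoot.apply_comm {δ : ℝ} {T Q : H →L[ℂ] H} (h : IsRoot δ T Q) (x : H) :
    Q (T x) = T (Q x) := congrArg (fun A : H →L[ℂ] H => A x) h.commute.eq

theorem IsGeneric.eq_zero_of_apply_apply {δ : ℝ} {T : H →L[ℂ] H} (hT : IsGeneric δ T) {x : H}
    (h : T (T x) = (4 * δ : ℂ) • x) : x = 0 := by
  by_contra hx
  refine hT.not_mem_spectrum_sq (mem_spectrum_of_eigenvector hx ?_)
  rw [pow_two, mul_apply_eq_comp, h]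
  push_cast
  rfl

theorem IsRoot.isUnit {δ : ℝ} {T Q : H →L[ℂ] H} (hT : IsGeneric δ T) (h : IsRoot δ T Q) :
    IsUnit Q := by
  have := hT.finiteDimensional
  refine isUnit_of_injective fun x hx => hT.eq_zero_of_apply_apply ?_
  rw [← sub_eq_zero, ← h.apply_apply, hx, map_zero]

/-- `J` commutes with `diag(1, u)`, so this reduces to `(T² - Q²)/4 = δ` and to `T` and `Q`
commuting. -/
theorem conjZ_mul_symJ_conjZ_symJ {δ : ℝ} {T Q : H →L[ℂ] H} (hQ : IsRoot δ T Q)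
    (u : (H →L[ℂ] H)ˣ) : conjZ T Q u * (symJ * conjZ T Q u * symJ) = (δ : ℂ) • 1 := by
  ext1 v
  obtain ⟨x, y⟩ := v
  rw [mul_apply_eq_comp, symJ_conjZ_symJ_apply, conjZ_apply]
  simp only [map_smul, unit_inv_apply, map_sub, hQ.apply_apply, hQ.apply_comm, smul_apply,
    one_apply_eq_self, ← WithLp.toLp_smul, map_add, unit_apply_inv, Prod.smul_mk]
  congr 2 <;> module

theorem symJ_conjZ_symJ_mul_conjZ {δ : ℝ} {T Q : H →L[ℂ] H} (hQ : IsRoot δ T Q)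
    (u : (H →L[ℂ] H)ˣ) : symJ * conjZ T Q u * symJ * conjZ T Q u = (δ : ℂ) • 1 := by
  ext1 v
  obtain ⟨x, y⟩ := v
  rw [mul_apply_eq_comp, conjZ_apply, symJ_conjZ_symJ_apply]
  simp only [map_smul, unit_inv_apply, map_sub, hQ.apply_apply, hQ.apply_comm, smul_apply,
    one_apply_eq_self, ← WithLp.toLp_smul, map_add, unit_apply_inv, Prod.smul_mk]
  congr 2 <;> module

theorem isUnit_conjZ_and_inverse {δ : ℝ} (hδ : δ ≠ 0) {T Q : H →L[ℂ] H} (hQ : IsRoot δ T Q)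
    (u : (H →L[ℂ] H)ˣ) : IsUnit (conjZ T Q u) ∧
      (δ : ℂ) • Ring.inverse (conjZ T Q u) = symJ * conjZ T Q u * symJ := by
  have hδ' : (δ : ℂ) ≠ 0 := Complex.ofReal_ne_zero.2 hδ
  let U : (DSum H →L[ℂ] DSum H)ˣ :=
    ⟨conjZ T Q u, (δ : ℂ)⁻¹ • (symJ * conjZ T Q u * symJ),
      by
        refine (ContinuousLinearMap.comp_smul _ _ _).trans ?_
        exact (congrArg _ (conjZ_mul_symJ_conjZ_symJ hQ u)).trans (inv_smul_smul₀ hδ' _),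
      by
        refine (ContinuousLinearMap.smul_comp _ _ _).trans ?_
        exact (congrArg _ (symJ_conjZ_symJ_mul_conjZ hQ u)).trans (inv_smul_smul₀ hδ' _)⟩
  refine ⟨⟨U, rfl⟩, ?_⟩
  rw [show Ring.inverse (conjZ T Q u) = (δ : ℂ)⁻¹ • (symJ * conjZ T Q u * symJ) from
    Ring.inverse_unit U, smul_inv_smul₀ hδ']

theorem encard_eigenvalues_le (V : Type*) [AddCommGroup V] [Module ℂ V] [FiniteDimensional ℂ V]
    (f : Module.End ℂ V) : {z : ℂ | f.HasEigenvalue z}.encard ≤ Module.finrank ℂ V := by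
  have h1 : {z : ℂ | f.HasEigenvalue z} ⊆ (f.charpoly.roots.toFinset : Set ℂ) := by
    intro z hz
    rw [Finset.mem_coe, Multiset.mem_toFinset, Polynomial.mem_roots f.charpoly_monic.ne_zero]
    exact (f.hasEigenvalue_iff_isRoot_charpoly z).1 hz
  refine (Set.encard_le_encard h1).trans ?_
  rw [Set.encard_coe_eq_coe_finsetCard, ← f.charpoly_natDegree]
  exact_mod_cast (Multiset.toFinset_card_le _).trans (Polynomial.card_roots' _)

/-- The eigenvector is the image of the companion eigenvector `(-μ x, x)` under `(h, k) ↦ (h + T k /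
2, -u Q k / 2)`. -/
theorem hasEigenvalue_conjZ {δ : ℝ} {T Q : H →L[ℂ] H} (hT : IsGeneric δ T) (hQ : IsRoot δ T Q)
    (u : (H →L[ℂ] H)ˣ) {t μ : ℂ} (ht : t ∈ spectrum ℂ T) (h : μ ^ 2 - t * μ + δ = 0) :
    Module.End.HasEigenvalue (conjZ T Q u : DSum H →ₗ[ℂ] DSum H) μ := by
  have := hT.finiteDimensional
  obtain ⟨x, hx, hTx⟩ := exists_eigenvector_of_mem_spectrum ht
  obtain ⟨q, hq⟩ := hQ.isUnit hT
  have hδ : (δ : ℂ) = t * μ - μ ^ 2 := by linear_combination h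
  refine Module.End.hasEigenvalue_of_hasEigenvector
    (x := WithLp.toLp 2 ((t / 2 - μ) • x, -(1 / 2 : ℂ) • (u : H →L[ℂ] H) (Q x))) ⟨?_, ?_⟩
  · rw [Module.End.mem_eigenspace_iff]
    change conjZ T Q u _ = _
    rw [conjZ_apply]
    simp only [map_smul, unit_inv_apply, map_add, hQ.apply_apply, hTx, ← hQ.apply_comm, hδ,
      ← WithLp.toLp_smul, Prod.smul_mk]
    congr 2 <;> module
  · intro h0
    have h1 := congrArg (fun v : DSum H => v.snd) h0
    have h2 : (u : H →L[ℂ] H) (Q x) = 0 :=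
      (smul_eq_zero.1 (show -(1 / 2 : ℂ) • (u : H →L[ℂ] H) (Q x) = 0 from h1)).resolve_left
        (by norm_num)
    have h3 : Q x = 0 := by rw [← unit_inv_apply u (Q x), h2, map_zero]
    refine hx ?_
    rw [← unit_inv_apply q x, hq, h3, map_zero]

theorem IsGeneric.sq_ne {δ : ℝ} {T : H →L[ℂ] H} (hT : IsGeneric δ T) {t : ℂ}
    (ht : t ∈ spectrum ℂ T) : t ^ 2 - 4 * δ ≠ 0 := by
  have := hT.finiteDimensional
  obtain ⟨x, hx, hTx⟩ := exists_eigenvector_of_mem_spectrum ht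
  intro h
  refine hx (hT.eq_zero_of_apply_apply ?_)
  rw [hTx, map_smul, hTx, smul_smul, ← pow_two, sub_eq_zero.1 h]

/-- Each `t ∈ σ(T)` yields two roots of `μ² - t μ + δ`, distinct because `t² ≠ 4δ`. Different `t`
share no root, since `t = μ + δ / μ` is recovered from `μ`. -/
theorem encard_eigenvalues_conjZ {δ : ℝ} (hδ : δ ≠ 0) {T Q : H →L[ℂ] H} (hT : IsGeneric δ T)
    (hQ : IsRoot δ T Q) (u : (H →L[ℂ] H)ˣ) :
    {z : ℂ | Module.End.HasEigenvalue (conjZ T Q u : DSum H →ₗ[ℂ] DSum H) z}.encard =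
      2 * Module.finrank ℂ H := by
  have := hT.finiteDimensional
  have hδ' : (δ : ℂ) ≠ 0 := Complex.ofReal_ne_zero.2 hδ
  refine le_antisymm ?_ ?_
  · refine (encard_eigenvalues_le (DSum H) _).trans (le_of_eq ?_)
    rw [LinearEquiv.finrank_eq (WithLp.linearEquiv 2 ℂ (H × H)), Module.finrank_prod, ← two_mul]
    norm_cast
  · choose d hd using fun t : ℂ => IsAlgClosed.exists_pow_nat_eq (t ^ 2 - 4 * δ) two_pos
    have hroot : ∀ e : ℂ, e ^ 2 = 1 → ∀ t, ((t + e * d t) / 2) ^ 2 - t * ((t + e * d t) / 2) + δ =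
        0 := fun e he t => by
      linear_combination (d t ^ 2 / 4) * he + hd t / 4
    have hinj : ∀ {μ t s : ℂ}, μ ^ 2 - t * μ + δ = 0 → μ ^ 2 - s * μ + δ = 0 → t = s := by
      intro μ t s h1 h2
      have hμ : μ ≠ 0 := by
        rintro rfl
        exact hδ' (by linear_combination h1)
      exact mul_right_cancel₀ hμ (by linear_combination h2 - h1)
    have hinjOn : ∀ e : ℂ, e ^ 2 = 1 →
        Set.InjOn (fun t => (t + e * d t) / 2) (spectrum ℂ T) := fun e he t _ s _ hts => by
      refine hinj (hroot e he t) ?_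
      have h1 := hroot e he s
      rwa [← (show (t + e * d t) / 2 = (s + e * d s) / 2 from hts)] at h1
    have hdisj : Disjoint ((fun t => (t + 1 * d t) / 2) '' spectrum ℂ T)
        ((fun t => (t + -1 * d t) / 2) '' spectrum ℂ T) := by
      rw [Set.disjoint_left]
      rintro _ ⟨t, ht, rfl⟩ ⟨s, -, hs⟩
      have hs' : (s + -1 * d s) / 2 = (t + 1 * d t) / 2 := hs
      have h1 := hroot (-1) (by norm_num) s
      rw [hs'] at h1
      have hst : t = s := hinj (hroot 1 (by norm_num) t) h1
      subst hst
      refine hT.sq_ne ht ?_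
      have h2 : d t = 0 := by linear_combination -hs'
      rw [← hd, h2]
      ring
    rw [two_mul, ← hT.card_spectrum]
    nth_rewrite 1 [← (hinjOn 1 (by norm_num)).encard_image]
    rw [← (hinjOn (-1) (by norm_num)).encard_image, ← Set.encard_union_eq hdisj]
    refine Set.encard_le_encard ?_
    rintro _ (⟨t, ht, rfl⟩ | ⟨t, ht, rfl⟩)
    · exact hasEigenvalue_conjZ hT hQ u ht (hroot 1 (by norm_num) t)
    · exact hasEigenvalue_conjZ hT hQ u ht (hroot (-1) (by norm_num) t)

/-- The entry is `Q u⁻¹ / 2`, a product of invertible operators. -/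
theorem zero_not_mem_spectrum_entry12_conjZ {δ : ℝ} {T Q : H →L[ℂ] H} (hT : IsGeneric δ T)
    (hQ : IsRoot δ T Q) (u : (H →L[ℂ] H)ˣ) : (0 : ℂ) ∉ spectrum ℂ (entry12 (conjZ T Q u)) := by
  have := hT.finiteDimensional
  obtain ⟨q, hq⟩ := hQ.isUnit hT
  intro h
  obtain ⟨y, hy, h0⟩ := exists_eigenvector_of_mem_spectrum h
  rw [entry12_apply, conjZ_apply, zero_smul, map_zero, zero_add] at h0
  have h1 : Q ((↑u⁻¹ : H →L[ℂ] H) y) = 0 :=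
    (smul_eq_zero.1 (show (1 / 2 : ℂ) • Q ((↑u⁻¹ : H →L[ℂ] H) y) = 0 from h0)).resolve_left
      (by norm_num)
  have h2 : (↑u⁻¹ : H →L[ℂ] H) y = 0 := by
    rw [← unit_inv_apply q ((↑u⁻¹ : H →L[ℂ] H) y), hq, h1, map_zero]
  refine hy ?_
  rw [← unit_apply_inv u y, h2, map_zero]

theorem isGerminator_conjZ {δ : ℝ} (hδ : δ ≠ 0) {T Q : H →L[ℂ] H} (hT : IsGeneric δ T)
    (hQ : IsRoot δ T Q) (u : (H →L[ℂ] H)ˣ) (hC : ‖conjZ T Q u‖ ≤ 1) :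
    IsGerminator δ (conjZ T Q u) where
  finiteDimensional := hT.finiteDimensional
  norm_le_one := hC
  card_eigenvalues := encard_eigenvalues_conjZ hδ hT hQ u
  isUnit := (isUnit_conjZ_and_inverse hδ hQ u).1
  inverse_eq := (isUnit_conjZ_and_inverse hδ hQ u).2
  zero_not_mem_spectrum := zero_not_mem_spectrum_entry12_conjZ hT hQ u

/-! ### Contractive conjugates and the numerical range. -/

theorem exists_norm_conjZ_le_one [CompleteSpace H] {δ : ℝ} (hδ : δ ∈ Set.Ioo (0 : ℝ) 1)
    {T Q : H →L[ℂ] H} (hT : IsGeneric δ T) (hQ : IsRoot δ T Q)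
    (hW : numericalRange T ⊆ ellipse δ) : ∃ u : (H →L[ℂ] H)ˣ, ‖conjZ T Q u‖ ≤ 1 := by
  have := hT.finiteDimensional
  obtain ⟨D, hD, hle⟩ := exists_isPositive_of_numericalRange_subset hδ hW
  let R : H →L[ℂ] H := CFC.sqrt D
  have hR : IsSelfAdjoint R := IsSelfAdjoint.of_nonneg (CFC.sqrt_nonneg D)
  have hRR : R * R = D := CFC.sqrt_mul_sqrt_self D
    ((ContinuousLinearMap.nonneg_iff_isPositive D).2 hD)
  have hRD : ∀ k, (inner ℂ k (D k)).re = ‖R k‖ ^ 2 := by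
    intro k
    rw [← hRR, mul_apply_eq_comp, ← ContinuousLinearMap.adjoint_inner_left,
      ContinuousLinearMap.isSelfAdjoint_iff'.1 hR]
    exact inner_self_eq_norm_sq (𝕜 := ℂ) _
  simp only [hRD] at hle
  have hRu : IsUnit R := by
    refine isUnit_of_injective fun k hk => hT.eq_zero_of_apply_apply ?_
    -- If `R k = 0`, the right side vanishes at `h = -T k / 2`; hence so does the left, which forces
    -- `T² k = 4δ k`.
    have h1 := hle (-(((1 / 2 : ℝ) : ℂ) • T k)) k
    rw [hk, neg_add_cancel, norm_zero] at h1
    have h2 : ‖((1 / 2 : ℝ) : ℂ) • T (-(((1 / 2 : ℝ) : ℂ) • T k)) + (δ : ℂ) • k‖ = 0 := by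
      rw [← sq_eq_zero_iff]
      refine le_antisymm ?_ (sq_nonneg _)
      nlinarith [sq_nonneg ‖R (-(((1 / 2 : ℝ) : ℂ) • T k))‖]
    rw [norm_eq_zero, map_neg, map_smul] at h2
    have h3 := congrArg (fun v => (-4 : ℂ) • v) h2
    simp only [smul_zero] at h3
    push_cast at h3
    rw [← sub_eq_zero, ← h3]
    module
  obtain ⟨r, hr⟩ := hRu
  obtain ⟨q, hq⟩ := hQ.isUnit hT
  have hu : ∀ x, ((r * q⁻¹ : (H →L[ℂ] H)ˣ) : H →L[ℂ] H) (Q x) = R x := by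
    intro x
    rw [Units.val_mul, mul_apply_eq_comp, ← hq, unit_inv_apply, hr]
  have hui : ∀ x, (((r * q⁻¹)⁻¹ : (H →L[ℂ] H)ˣ) : H →L[ℂ] H) (R x) = Q x := by
    intro x
    rw [← hu, unit_inv_apply]
  refine ⟨r * q⁻¹, ContinuousLinearMap.opNorm_le_bound _ zero_le_one fun v => ?_⟩
  obtain ⟨x, y⟩ := v
  -- Every vector has the form `(h + T k / 2, -R k / 2)`. In these coordinates the operator acts as
  -- `(h, k) ↦ (T h + δ k, -h)`, so the norm bound is `hle h k`.
  obtain ⟨k, rfl⟩ : ∃ k, y = -(((1 / 2 : ℝ) : ℂ) • R k) := by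
    refine ⟨(-2 : ℂ) • (↑r⁻¹ : H →L[ℂ] H) y, ?_⟩
    rw [map_smul, ← hr, unit_apply_inv]
    push_cast
    module
  obtain ⟨h, rfl⟩ : ∃ h, x = h + ((1 / 2 : ℝ) : ℂ) • T k :=
    ⟨x - ((1 / 2 : ℝ) : ℂ) • T k, by rw [sub_add_cancel]⟩
  rw [one_mul, ← sq_le_sq₀ (norm_nonneg _) (norm_nonneg _), conjZ_apply]
  have e1 : (1 / 2 : ℂ) • (T (h + ((1 / 2 : ℝ) : ℂ) • T k) +
      Q ((((r * q⁻¹)⁻¹ : (H →L[ℂ] H)ˣ) : H →L[ℂ] H) (-(((1 / 2 : ℝ) : ℂ) • R k)))) =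
      ((1 / 2 : ℝ) : ℂ) • T h + (δ : ℂ) • k := by
    rw [map_neg, map_smul, hui, map_neg, map_smul, hQ.apply_apply, map_add, map_smul]
    push_cast
    module
  have e2 : (1 / 2 : ℂ) • ((r * q⁻¹ : (H →L[ℂ] H)ˣ) : H →L[ℂ] H) (Q (h + ((1 / 2 : ℝ) : ℂ) • T k) +
      T ((((r * q⁻¹)⁻¹ : (H →L[ℂ] H)ˣ) : H →L[ℂ] H) (-(((1 / 2 : ℝ) : ℂ) • R k)))) =
      ((1 / 2 : ℝ) : ℂ) • R h := by
    rw [map_neg, map_smul, hui, map_neg, map_smul, map_add Q, map_smul, hQ.apply_comm,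
      add_neg_cancel_right, hu]
    push_cast
    rfl
  rw [e1, e2, WithLp.prod_norm_sq_eq_of_L2, WithLp.prod_norm_sq_eq_of_L2]
  change ‖((1 / 2 : ℝ) : ℂ) • T h + (δ : ℂ) • k‖ ^ 2 + ‖((1 / 2 : ℝ) : ℂ) • R h‖ ^ 2 ≤
    ‖h + ((1 / 2 : ℝ) : ℂ) • T k‖ ^ 2 + ‖-(((1 / 2 : ℝ) : ℂ) • R k)‖ ^ 2
  rw [norm_neg, norm_real_smul_sq, norm_real_smul_sq]
  have h1 := hle h k
  norm_num at h1 ⊢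
  linarith

theorem add_symJ_conjZ_symJ_apply (T Q : H →L[ℂ] H) (u : (H →L[ℂ] H)ˣ) (h : H) :
    (conjZ T Q u + symJ * conjZ T Q u * symJ : DSum H →L[ℂ] DSum H) (WithLp.toLp 2 (h, 0)) = WithLp.toLp 2 (T h, 0) := by
  rw [add_apply, symJ_conjZ_symJ_apply, conjZ_apply, ← WithLp.toLp_add, Prod.mk_add_mk]
  simp only [map_zero, map_add, map_sub]
  congr 2 <;> module

theorem numericalRange_subset_of_norm_conjZ_le_one {δ : ℝ} (hδ : δ ∈ Set.Ioo (0 : ℝ) 1)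
    {T Q : H →L[ℂ] H} (hQ : IsRoot δ T Q) {u : (H →L[ℂ] H)ˣ} (hC : ‖conjZ T Q u‖ ≤ 1) :
    numericalRange T ⊆ ellipse δ := by
  rintro _ ⟨h, hh, rfl⟩
  rw [mem_ellipse_iff hδ]
  set C := conjZ T Q u with hCdef
  set v : DSum H := WithLp.toLp 2 (h, 0) with hv
  set z := inner ℂ h (T h) with hz
  have hvn : ‖v‖ = 1 := by
    rw [← sq_eq_sq₀ (norm_nonneg _) zero_le_one, WithLp.prod_norm_sq_eq_of_L2]
    simp [hv, hh]
  set w : DSum H := (symJ * C * symJ : DSum H →L[ℂ] DSum H) v with hw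
  have hCw : C w = (δ : ℂ) • v := by
    rw [hw, ← mul_apply_eq_comp, hCdef, conjZ_mul_symJ_conjZ_symJ hQ]
    rfl
  have hCv : C v = WithLp.toLp 2 ((1 / 2 : ℂ) • T h, (1 / 2 : ℂ) • (u : H →L[ℂ] H) (Q h)) := by
    rw [hCdef, hv, conjZ_apply]
    simp
  have hwv : w = WithLp.toLp 2 ((1 / 2 : ℂ) • T h, -((1 / 2 : ℂ) • (u : H →L[ℂ] H) (Q h))) := by
    rw [hw, hCdef, hv, symJ_conjZ_symJ_apply]
    simp
  have hnorm : ‖w‖ ^ 2 = ‖C v‖ ^ 2 := by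
    rw [hwv, hCv, WithLp.prod_norm_sq_eq_of_L2, WithLp.prod_norm_sq_eq_of_L2]
    simp
  have hiv : inner ℂ v (C v) = (1 / 2) * z := by
    rw [hCv, hv, WithLp.prod_inner_apply]
    simp [inner_smul_right, hz]
  have hiw : inner ℂ v w = (1 / 2) * z := by
    rw [hwv, hv, WithLp.prod_inner_apply]
    simp [inner_smul_right, hz]
  have hivC : inner ℂ (C v) v = (1 / 2) * conj z := by
    rw [← inner_conj_symm, hiv, map_mul, map_div₀, map_one, map_ofNat]
  -- Contractivity is applied to `w - ā v`. Because `‖w‖ = ‖C v‖`, the unknown norms cancel and only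
  -- the cross terms and `1 - δ²` remain.
  have key : ∀ a : ℂ, ‖a‖ = 1 → (a * (z - δ * conj z)).re ≤ 1 - δ ^ 2 := by
    intro a ha
    have h1 : ‖(-conj a) • C v + (δ : ℂ) • v‖ ≤ ‖(-conj a) • v + w‖ := by
      rw [← hCw, ← map_smul, ← map_add]
      exact (C.le_opNorm _).trans (mul_le_of_le_one_left (norm_nonneg _) hC)
    have h2 := pow_le_pow_left₀ (norm_nonneg _) h1 2
    have h3 : ∀ x : DSum H, ‖(-conj a) • x‖ = ‖x‖ := fun x => by
      rw [norm_smul, norm_neg, Complex.norm_conj, ha, one_mul]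
    rw [norm_add_sq_complex, norm_add_sq_complex, h3, h3, hvn, norm_real_smul_sq, hvn, hnorm,
      re_inner_real_smul_right, inner_smul_left, inner_smul_left, hivC, hiw, map_neg,
      Complex.conj_conj] at h2
    have h4 : a * (z - δ * conj z) =
        (δ : ℂ) * (2 * (-a * (1 / 2 * conj z))) - 2 * (-a * (1 / 2 * z)) := by ring
    have h5 : ∀ y : ℂ, (2 * y).re = 2 * y.re := fun y => by simp
    rw [h4, Complex.sub_re, Complex.re_ofReal_mul, h5, h5]
    linarith
  rcases eq_or_ne (z - δ * conj z) 0 with h0 | h0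
  · rw [h0, norm_zero]
    nlinarith [hδ.1, hδ.2]
  set c := z - δ * conj z with hc
  have hcn : ‖c‖ ≠ 0 := norm_ne_zero_iff.2 h0
  -- This phase rotates `c` onto the positive real axis.
  have h1 := key (conj c / ‖c‖) (by
    rw [norm_div, Complex.norm_conj, Complex.norm_real, norm_norm, div_self hcn])
  have h2 : conj c / (‖c‖ : ℂ) * c = (‖c‖ : ℂ) := by
    rw [div_mul_eq_mul_div, mul_comm, Complex.mul_conj, Complex.normSq_eq_norm_sq,
      div_eq_iff (Complex.ofReal_ne_zero.2 hcn)]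
    push_cast
    ring
  rwa [h2, Complex.ofReal_re] at h1

/-! ### Existence of the square root and the main theorem. -/

/-- As `T` has `dim H` distinct eigenvalues, its eigenvectors form a basis; `Q` is diagonal in it,
with a chosen square root of `t² - 4δ` at each eigenvalue `t`. -/
theorem exists_isRoot {δ : ℝ} {T : H →L[ℂ] H} (hT : IsGeneric δ T) :
    ∃ Q : H →L[ℂ] H, IsRoot δ T Q := by
  have := hT.finiteDimensional
  have hfin : (spectrum ℂ T).Finite := Set.finite_of_encard_eq_coe hT.card_spectrum
  have : Fintype (spectrum ℂ T) := hfin.fintype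
  choose x hx hTx using fun t : spectrum ℂ T => exists_eigenvector_of_mem_spectrum t.2
  choose d hd using fun t : ℂ => IsAlgClosed.exists_pow_nat_eq (t ^ 2 - 4 * δ) two_pos
  have hli : LinearIndependent ℂ x :=
    Module.End.eigenvectors_linearIndependent' (T : H →ₗ[ℂ] H) (fun t : spectrum ℂ T => (t : ℂ))
      Subtype.coe_injective x fun t => ⟨Module.End.mem_eigenspace_iff.2 (hTx t), hx t⟩
  have hcard : Fintype.card (spectrum ℂ T) = Module.finrank ℂ H := by
    have h1 := hT.card_spectrum
    rw [Set.encard_eq_coe_toFinset_card, Set.toFinset_card] at h1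
    exact_mod_cast h1
  let b : Module.Basis (spectrum ℂ T) ℂ H :=
    Module.Basis.mk hli (hli.span_eq_top_of_card_eq_finrank' hcard).ge
  have hb : ∀ t, b t = x t := fun t => Module.Basis.mk_apply _ _ t
  let Q : H →L[ℂ] H := LinearMap.toContinuousLinearMap (b.constr ℂ fun t => d t • x t)
  have hQ : ∀ t, Q (x t) = d t • x t := by
    intro t
    rw [← hb]
    exact (b.constr_basis ℂ _ t).trans (by rw [hb])
  have hext : ∀ A B : H →L[ℂ] H, (∀ t, A (x t) = B (x t)) → A = B := by
    intro A B hAB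
    refine ContinuousLinearMap.coe_injective (b.ext fun t => ?_)
    rw [hb]
    exact hAB t
  refine ⟨Q, hext _ _ fun t => ?_, hext _ _ fun t => ?_⟩
  · simp only [mul_apply_eq_comp, hTx, hQ, map_smul]
    exact smul_comm _ _ _
  · simp only [pow_two, mul_apply_eq_comp, sub_apply, smul_apply, one_apply_eq_self, hTx, hQ,
      map_smul, smul_smul, ← sub_smul]
    rw [← pow_two, hd]
    push_cast
    ring_nf

end

end EllipseRange

theorem mainTheorem4 {H : Type*} [NormedAddCommGroup H] [InnerProductSpace ℂ H] [CompleteSpace H]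
    (δ : ℝ) (hδ : δ ∈ Set.Ioo (0 : ℝ) 1) (T : H →L[ℂ] H) (hT : EllipseRange.IsGeneric δ T) :
    (∃ Q : H →L[ℂ] H, EllipseRange.IsRoot δ T Q) ∧
    ∀ Q : H →L[ℂ] H, EllipseRange.IsRoot δ T Q →
      ((EllipseRange.numericalRange T ⊆ EllipseRange.ellipse δ ↔
        ∃ (C : EllipseRange.DSum H →L[ℂ] EllipseRange.DSum H) (S : H →L[ℂ] H),
          EllipseRange.IsGerminator δ C ∧ IsUnit S ∧
            C = EllipseRange.diagOne S * EllipseRange.opZ T Q *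
              Ring.inverse (EllipseRange.diagOne S)) ∧
      ∀ (C : EllipseRange.DSum H →L[ℂ] EllipseRange.DSum H) (S : H →L[ℂ] H),
        EllipseRange.IsGerminator δ C → IsUnit S →
          C = EllipseRange.diagOne S * EllipseRange.opZ T Q *
            Ring.inverse (EllipseRange.diagOne S) →
          ∀ h : H, (C + (δ : ℂ) • Ring.inverse C) (WithLp.toLp 2 (h, 0)) =
            WithLp.toLp 2 (T h, 0)) := by
  refine ⟨EllipseRange.exists_isRoot hT, fun Q hQ => ⟨⟨fun hW => ?_, ?_⟩, ?_⟩⟩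
  · obtain ⟨u, hu⟩ := EllipseRange.exists_norm_conjZ_le_one hδ hT hQ hW
    exact ⟨_, u, EllipseRange.isGerminator_conjZ hδ.1.ne' hT hQ u hu, u.isUnit, rfl⟩
  · rintro ⟨C, S, hC, ⟨u, rfl⟩, rfl⟩
    exact EllipseRange.numericalRange_subset_of_norm_conjZ_le_one hδ hQ hC.norm_le_one
  · rintro C S hC ⟨u, rfl⟩ rfl h
    rw [hC.inverse_eq]
    exact EllipseRange.add_symJ_conjZ_symJ_apply T Q u h
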